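/- Graphs are finite multigraphs; loops and parallel edges are permitted, and a loop contributes $2$ to the degree of its vertex. A graph is cubic if every vertex has degree $3$. A forest is a graph without cycles (loops and pairs of parallel edges count as cycles), and a tree is a connected forest. A set $J$ of vertices of a graph $G$ is independent if the induced subgraph $G[J]$ has no edges (in particular, no loops), and near-independent if $G[J]$ has exactly one edge (possibly a loop). Cellular embeddings of a connected graph in closed orientable surfaces are described by rotation systems: a cyclic order of the half-edges at each vertex, the faces being the orbits of the face-tracing permutation on half-edges. A graph is upper-embeddable if it has a cellular embedding in a closed orientable surface with at most two faces. A stable decycling partition of $G$ is a partition $\{A,J\}$ of $V(G)$ of one of the following three types: $A$ induces a tree and $J$ is independent; $A$ induces a tree and $J$ is near-independent; $A$ induces a forest with exactly two components and $J$ is independent. Theorem. Let $G$ be a connected cubic graph. (a) The following statements are equivalent: (i) $G$ has a cellular embedding in a closed orientable surface with exactly two faces; (ii) the vertex set of $G$ can be partitioned into two sets $A$ and $J$ such that either (1) $A$ induces a tree and $J$ is near-independent, or (2) $A$ induces a forest with exactly two components and $J$ is independent. (b) $G$ admits a stable decycling partition if and only if $G$ is upper-embeddable. -/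

import Mathlib

open scoped Graph

/-!
Graphs are multigraphs, with loops and parallel edges allowed (Mathlib's `Graph α β`, with vertex
set `V(G)` and edge set `E(G)`).
-/

namespace CubicDecycling

section

universe u v

/-- The degree of a vertex: the number of incident edges, where every loop counts twice. -/
noncomputable def degree {α : Type u} {β : Type v} (G : Graph α β) (x : α) : ℕ :=
  {e | G.IsNonloopAt e x}.ncard + 2 * {e | G.IsLoopAt e x}.ncard

/-- A cubic graph: finite, and every vertex has degree three. -/
structure IsCubic {α : Type u} {β : Type v} (G : Graph α β) : Prop where
  finite_vertexSet : V(G).Finite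
  finite_edgeSet : E(G).Finite
  degree_eq : ∀ x ∈ V(G), degree G x = 3

/-- Connectedness (which includes having a vertex); it does not depend on loops or on the
multiplicity of edges. -/
def IsConnected {α : Type u} {β : Type v} (G : Graph α β) : Prop :=
  G.toSimpleGraph.Connected

/-- The number of connected components. -/
noncomputable def numComponents {α : Type u} {β : Type v} (G : Graph α β) : ℕ :=
  Nat.card G.toSimpleGraph.ConnectedComponent

/-- A forest: no cycles.  A loop is a cycle of length one and a pair of parallel edges is a cycle
of length two, so that a forest is a simple graph (no loops, no parallel edges) without cycles of
length at least three. -/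
def IsForest {α : Type u} {β : Type v} (G : Graph α β) : Prop :=
  G.Simple ∧ G.toSimpleGraph.IsAcyclic

/-- A tree: a connected forest. -/
def IsTree {α : Type u} {β : Type v} (G : Graph α β) : Prop :=
  IsConnected G ∧ IsForest G

/-- `J` is independent: the subgraph induced by `J` has no edge (in particular no loop). -/
def IsIndependent {α : Type u} {β : Type v} (G : Graph α β) (J : Set α) : Prop :=
  E(G.induce J) = ∅

/-- `J` is near-independent: the subgraph induced by `J` has exactly one edge (possibly a loop). -/
def IsNearIndependent {α : Type u} {β : Type v} (G : Graph α β) (J : Set α) : Prop :=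
  ∃! e, e ∈ E(G.induce J)

/-- `{A, J}` is a partition of the vertex set of `G`. -/
def IsVertexPartition {α : Type u} {β : Type v} (G : Graph α β) (A J : Set α) : Prop :=
  A ∪ J = V(G) ∧ Disjoint A J

/-- A cellular embedding of a graph without isolated vertices in a closed oriented surface, given
combinatorially by a rotation system.

Each edge `e` has two darts (half-edges) `(e, false)` and `(e, true)`, one at either end; `src d` is
the vertex at which the dart `d` starts (both darts of a loop start at the same vertex).  At every
vertex the surface induces a cyclic order on the darts that start there: `rot d` is the successor of
`d` in the order at `src d`, so the cycles of the permutation `rot` are exactly the sets of darts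
with a common source. -/
structure CellularEmbedding {α : Type u} {β : Type v} (G : Graph α β) where
  src : E(G) × Bool → α
  isLink : ∀ e : E(G), G.IsLink e (src (e, false)) (src (e, true))
  rot : Equiv.Perm (E(G) × Bool)
  sameCycle_rot_iff : ∀ d d' : E(G) × Bool, rot.SameCycle d d' ↔ src d = src d'

/-- The reversal of darts: it swaps the two darts of every edge. -/
def dartRev {α : Type u} {β : Type v} (G : Graph α β) : Equiv.Perm (E(G) × Bool) where
  toFun d := (d.1, !d.2)
  invFun d := (d.1, !d.2)
  left_inv := by rintro ⟨e, b⟩; simp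
  right_inv := by rintro ⟨e, b⟩; simp

/-- Face tracing: the boundary walk of a face runs along the dart `d`, and at the other end of `d`
it leaves along the dart that follows the reverse of `d` in the rotation. -/
def CellularEmbedding.face {α : Type u} {β : Type v} {G : Graph α β} (M : CellularEmbedding G) :
    Equiv.Perm (E(G) × Bool) :=
  M.rot * dartRev G

/-- The number of faces.  The faces correspond to their boundary walks, that is, to the cycles of
the face tracing permutation (fixed points included). -/
noncomputable def CellularEmbedding.numFaces {α : Type u} {β : Type v} {G : Graph α β}
    (M : CellularEmbedding G) : ℕ :=
  Nat.card (Quotient (Equiv.Perm.SameCycle.setoid M.face))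

/-- `G` is upper-embeddable: it has a cellular embedding in a closed orientable surface with at most
two faces. -/
def IsUpperEmbeddable {α : Type u} {β : Type v} (G : Graph α β) : Prop :=
  ∃ M : CellularEmbedding G, M.numFaces ≤ 2

/-- `{A, J}` is a stable decycling partition of `G`: a partition of the vertex set of one of the
three types
* `A` induces a tree and `J` is independent;
* `A` induces a tree and `J` is near-independent;
* `A` induces a forest of two trees and `J` is independent. -/
def IsStableDecyclingPartition {α : Type u} {β : Type v} (G : Graph α β) (A J : Set α) : Prop :=
  IsVertexPartition G A J ∧
    ((IsTree (G.induce A) ∧ IsIndependent G J) ∨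
      (IsTree (G.induce A) ∧ IsNearIndependent G J) ∨
      (IsForest (G.induce A) ∧ numComponents (G.induce A) = 2 ∧ IsIndependent G J))

end

end CubicDecycling

/-!
Let `ρ` be the reversal of the darts and `n` the number of vertices of the cubic graph `G`, which
has `3 * n / 2` edges.  A set `S` of vertices and a cyclic order of the three darts at every vertex
of `S` give a permutation `σ` of the darts that fixes all other darts (`IsRotationOn`).  The cycles
of `σ * ρ` are the faces of an embedding of the possibly disconnected graph that results from `G`
when every vertex outside `S` is split into three leaves.  The components of this graph
(`dartSetoid`) are those of `G[S]` with their pendant edges, together with the edges that have no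
end in `S`; so their number is `c(G[S]) + e(G[V \ S])` (`card_dartSetoid_eq`).  It is at least
`|E| - 2 * |S|`, since adding a vertex to `S` merges at most three components into one, and equality
holds exactly if `G[S]` is a forest (`isForest_induce_iff`).  Hence both parts of the theorem follow
from one claim for `k = 1` and `k = 2`: there is an embedding with `k` faces if and only if there is
a partition `{A, J}` such that `A` is nonempty, `G[A]` is a forest and `c(G[A]) + e(G[J]) = k`.

Adding or erasing a vertex multiplies `σ * ρ` by a 3-cycle, that is, by two transpositions, each of
which merges two cycles or splits one.

*From partitions to embeddings.*  While the vertices of the forest `A` are added, each of them has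
its darts in three components, so in three faces, which are merged; in the end each component has
one face, and there are `k` faces (`exists_isRotationOn_numCycles_eq_card_dartSetoid`).  For a
vertex of `J`, at least two of its darts lie in the same face as `k ≤ 2`, and then one of the two
rotations at the vertex preserves the number of faces (`IsRotationOn.exists_extension`).

*From embeddings to partitions.*  Vertices are erased from the rotation of an embedding with `k`
faces as long as this is possible without a change of the number of faces; let `S` be the set of the
vertices that remain.  A vertex that meets both of two faces can be erased, so that at the end each
component has just one face, and there are `k` components.  It remains to see that
`k ≤ |E| - 2 * |S|`.  To this end the darts of each face are numbered along its boundary walk, and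
the descents of `σ` are counted, as in Chapuy's proof of the trisection lemma for unicellular maps:
there is one for each edge and one for each face (`le_card_filter_descent`).  On the other hand each
of the darts that start outside `S` is one (weak) descent, while a vertex of `S` has a single
descent, as it can be erased if its rotation runs against the order along the face
(`IsRotationOn.card_filter_descent_le_one`).  Hence `|E| + k ≤ 3 * n - 2 * |S| = 2 * |E| - 2 * |S|`.
-/

namespace CubicDecycling

open Equiv Equiv.Perm

/-! ### Merging two classes of an equivalence relation -/

/-- The equivalence relation obtained from `r` by merging the classes of `a` and `b`. -/
def glue {X : Type*} (r : Setoid X) (a b : X) : Setoid X where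
  r x y := r x y ∨ ((r x a ∨ r x b) ∧ (r y a ∨ r y b))
  iseqv := by
    refine ⟨fun x => Or.inl (r.refl x), ?_, ?_⟩
    · rintro x y (h | ⟨h, h'⟩)
      · exact Or.inl (r.symm h)
      · exact Or.inr ⟨h', h⟩
    · rintro x y z (h | ⟨h, h'⟩) (k | ⟨k, k'⟩)
      · exact Or.inl (r.trans h k)
      · exact Or.inr ⟨k.imp (r.trans h) (r.trans h), k'⟩
      · exact Or.inr ⟨h, h'.imp (r.trans (r.symm k)) (r.trans (r.symm k))⟩
      · exact Or.inr ⟨h, k'⟩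

section glue

variable {X : Type*} {r t : Setoid X} {a b : X}

lemma le_glue : r ≤ glue r a b := fun _ _ h => Or.inl h

lemma glue_pair : glue r a b a b := Or.inr ⟨Or.inl (r.refl a), Or.inr (r.refl b)⟩

lemma glue_le (h : r ≤ t) (hab : t a b) : glue r a b ≤ t := by
  rintro x y (k | ⟨k, k'⟩)
  · exact h k
  · rcases k with k | k <;> rcases k' with k' | k'
    · exact t.trans (h k) (t.symm (h k'))
    · exact t.trans (h k) (t.trans hab (t.symm (h k')))
    · exact t.trans (h k) (t.trans (t.symm hab) (t.symm (h k')))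
    · exact t.trans (h k) (t.symm (h k'))

lemma glue_eq_self (hab : r a b) : glue r a b = r :=
  le_antisymm (glue_le le_rfl hab) le_glue

lemma card_quotient_eq_card_glue_add_one [Finite X] (hab : ¬ r a b) :
    Nat.card (Quotient r) = Nat.card (Quotient (glue r a b)) + 1 := by
  classical
  rw [← Finite.card_option]
  let F : Quotient r → Option (Quotient (glue r a b)) := fun q =>
    if q = Quotient.mk r b then none else some (Quotient.map id (fun _ _ h => le_glue h) q)
  have hF : ∀ x, F (Quotient.mk r x) = if r x b then none else some (Quotient.mk _ x) := by
    intro x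
    simp only [F, Quotient.eq]
    rfl
  -- The class of `b` is sent to `none`, so that the merged class comes from the class of `a` alone.
  refine Nat.card_congr (Equiv.ofBijective F ⟨?_, ?_⟩)
  · intro p q
    induction p using Quotient.inductionOn with | _ x
    induction q using Quotient.inductionOn with | _ y
    rw [hF, hF]
    by_cases hx : r x b <;> by_cases hy : r y b <;> simp only [hx, hy, if_true, if_false,
      Option.some_inj, reduceCtorEq, false_implies, Quotient.eq, true_implies]
    · exact r.trans hx (r.symm hy)
    · rintro (h | ⟨h, h'⟩)
      · exact h
      · exact r.trans (h.resolve_right hx) (r.symm (h'.resolve_right hy))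
  · rintro (_ | q)
    · exact ⟨Quotient.mk r b, by rw [hF, if_pos (r.refl b)]⟩
    · induction q using Quotient.inductionOn with | _ y
      by_cases hy : r y b
      · refine ⟨Quotient.mk r a, ?_⟩
        rw [hF, if_neg hab, Option.some_inj, Quotient.eq]
        exact Or.inr ⟨Or.inl (r.refl a), Or.inr hy⟩
      · exact ⟨Quotient.mk r y, by rw [hF, if_neg hy]⟩

lemma card_quotient_le_card_glue_add_one [Finite X] (r : Setoid X) (a b : X) :
    Nat.card (Quotient r) ≤ Nat.card (Quotient (glue r a b)) + 1 := by
  by_cases hab : r a b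
  · rw [glue_eq_self hab]; omega
  · exact (card_quotient_eq_card_glue_add_one hab).le

end glue

/-! ### Cycles of a permutation multiplied by a transposition -/

/-- The number of cycles of a permutation, fixed points included. -/
noncomputable def numCycles {X : Type*} (f : Perm X) : ℕ :=
  Nat.card (Quotient (SameCycle.setoid f))

section cycles

variable {X : Type*} {f : Perm X} {a b c : X}

lemma setoid_sameCycle_le {t : Setoid X} (h : ∀ x, t x (f x)) : SameCycle.setoid f ≤ t := by
  have hn : ∀ (n : ℕ) x, t x ((f ^ n) x) := by
    intro n
    induction n with
    | zero => exact fun x => t.refl x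
    | succ n ih => exact fun x => t.trans (h x) (by rw [pow_succ, mul_apply]; exact ih (f x))
  rintro x y ⟨i, rfl⟩
  obtain ⟨n, rfl | rfl⟩ := i.eq_nat_or_neg
  · simpa using hn n x
  · have := hn n ((f ^ (-(n : ℤ))) x)
    rw [← mul_apply, zpow_neg, zpow_natCast, mul_inv_cancel, one_apply] at this
    rw [zpow_neg, zpow_natCast]
    exact t.symm this

lemma sameCycle_of_numCycles_le_one [Finite X] (h : numCycles f ≤ 1) (x y : X) :
    f.SameCycle x y := by
  have : Subsingleton (Quotient (SameCycle.setoid f)) :=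
    Finite.card_le_one_iff_subsingleton.1 h
  exact Quotient.exact (s := SameCycle.setoid f) (Subsingleton.elim _ _)

variable [DecidableEq X]

lemma setoid_swap_mul_le (f : Perm X) (a b : X) :
    SameCycle.setoid (swap a b * f) ≤ glue (SameCycle.setoid f) a b := by
  refine setoid_sameCycle_le fun x => ?_
  have hx : (SameCycle.setoid f) x (f x) := sameCycle_apply_right.2 (SameCycle.refl f x)
  rw [mul_apply]
  by_cases ha : f x = a
  · rw [ha] at hx ⊢
    rw [swap_apply_left]
    exact (glue _ a b).trans (le_glue hx) glue_pair
  · by_cases hb : f x = b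
    · rw [hb] at hx ⊢
      rw [swap_apply_right]
      exact (glue _ a b).trans (le_glue hx) ((glue _ a b).symm glue_pair)
    · rw [swap_apply_of_ne_of_ne ha hb]
      exact le_glue hx

/-- As long as the orbit of a point avoids `a` and `b`, the factor `swap a b` does not affect it. -/
lemma swap_mul_pow_apply {x : X} {n : ℕ}
    (h : ∀ i, 0 < i → i ≤ n → (f ^ i) x ≠ a ∧ (f ^ i) x ≠ b) :
    ((swap a b * f) ^ n) x = (f ^ n) x := by
  induction n with
  | zero => rfl
  | succ n ih =>
    have hn := h (n + 1) n.succ_pos le_rfl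
    rw [pow_succ', mul_apply, ih fun i hi hin => h i hi (hin.trans n.le_succ), mul_apply,
      ← mul_apply f, ← pow_succ', swap_apply_of_ne_of_ne hn.1 hn.2]

variable [Finite X]

lemma sameCycle_swap_mul (hab : ¬ f.SameCycle a b) : (swap a b * f).SameCycle a b := by
  classical
  have hex : ∃ n, 0 < n ∧ (f ^ n) a = a := by
    obtain ⟨n, hn, -, h⟩ := (SameCycle.refl f a).exists_pow_eq''
    exact ⟨n, hn, h⟩
  obtain ⟨hpos, hret⟩ := Nat.find_spec hex
  obtain ⟨n, hn⟩ := Nat.exists_eq_succ_of_ne_zero hpos.ne'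
  rw [hn] at hret
  have key : ((swap a b * f) ^ n) a = (f ^ n) a := by
    refine swap_mul_pow_apply fun i hi hin => ⟨fun h => ?_, fun h => hab ⟨i, by simpa using h⟩⟩
    exact Nat.find_min hex (by omega) ⟨hi, h⟩
  refine ⟨(n + 1 : ℕ), ?_⟩
  rw [zpow_natCast, pow_succ', mul_apply, key, mul_apply, ← mul_apply f, ← pow_succ', hret,
    swap_apply_left]

lemma setoid_swap_mul (hab : ¬ f.SameCycle a b) :
    SameCycle.setoid (swap a b * f) = glue (SameCycle.setoid f) a b := by
  refine le_antisymm (setoid_swap_mul_le f a b) (glue_le ?_ (sameCycle_swap_mul hab))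
  have := setoid_swap_mul_le (swap a b * f) a b
  rw [swap_mul_self_mul] at this
  exact this.trans (glue_le le_rfl (sameCycle_swap_mul hab))

/-- Two cycles are merged. -/
lemma numCycles_swap_mul_of_not_sameCycle (hab : ¬ f.SameCycle a b) :
    numCycles f = numCycles (swap a b * f) + 1 := by
  rw [numCycles, numCycles, setoid_swap_mul hab]
  exact card_quotient_eq_card_glue_add_one hab

lemma not_sameCycle_swap_mul (hne : a ≠ b) (hab : f.SameCycle a b) :
    ¬ (swap a b * f).SameCycle a b := by
  classical
  have hex : ∃ n, (f ^ n) a = b := hab.exists_nat_pow_eq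
  have hmin := fun m => Nat.find_min (m := m) hex
  obtain ⟨n, hn⟩ := Nat.exists_eq_succ_of_ne_zero (n := Nat.find hex) (by
    intro h0
    have := Nat.find_spec hex
    rw [h0] at this
    exact hne this)
  have hret : (f ^ (n + 1)) a = b := by rw [← Nat.succ_eq_add_one, ← hn]; exact Nat.find_spec hex
  have key : ∀ m ≤ n, ((swap a b * f) ^ m) a = (f ^ m) a := by
    refine fun m hm => swap_mul_pow_apply fun i hi him => ⟨fun h => ?_, hmin i (by omega)⟩
    refine hmin (n + 1 - i) (by omega) ?_
    have : (f ^ (n + 1 - i)) ((f ^ i) a) = b := by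
      rw [← mul_apply, ← pow_add, Nat.sub_add_cancel (by omega), hret]
    rwa [h] at this
  have hper : Function.IsPeriodicPt (swap a b * f) (n + 1) a := by
    rw [Function.IsPeriodicPt, iterate_eq_pow, Function.IsFixedPt, pow_succ', mul_apply,
      key n le_rfl, mul_apply, ← mul_apply f, ← pow_succ', hret, swap_apply_right]
  intro h
  obtain ⟨m, hm⟩ := h.exists_nat_pow_eq
  rw [← iterate_eq_pow, ← hper.iterate_mod_apply, iterate_eq_pow,
    key _ (Nat.lt_succ_iff.1 (Nat.mod_lt _ n.succ_pos))] at hm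
  exact hmin _ (by have := Nat.mod_lt m n.succ_pos; omega) hm

/-- A cycle is split in two. -/
lemma numCycles_swap_mul_of_sameCycle (hne : a ≠ b) (hab : f.SameCycle a b) :
    numCycles (swap a b * f) = numCycles f + 1 := by
  have := numCycles_swap_mul_of_not_sameCycle (not_sameCycle_swap_mul hne hab)
  rwa [swap_mul_self_mul] at this

/-- If `f` has at most two cycles and meets `a`, `b` in different ones, then multiplication by the
first transposition leaves a single cycle, which the second one splits. -/
lemma numCycles_swap_mul_swap_mul_of_not_sameCycle (hbc : b ≠ c) (h2 : numCycles f ≤ 2)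
    (hab : ¬ f.SameCycle a b) : numCycles (swap b c * (swap a b * f)) = numCycles f := by
  have h1 := numCycles_swap_mul_of_not_sameCycle hab
  rw [numCycles_swap_mul_of_sameCycle hbc (sameCycle_of_numCycles_le_one (by omega) _ _), h1]

/-- If the splitting of a cycle at `a` and `b` separates `c` from `b`, then the second
transposition undoes the split. -/
lemma numCycles_swap_mul_swap_mul_of_sameCycle (hne : a ≠ b) (hab : f.SameCycle a b)
    (hbc : ¬ (swap a b * f).SameCycle b c) :
    numCycles (swap b c * (swap a b * f)) = numCycles f := by
  have h1 := numCycles_swap_mul_of_sameCycle hne hab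
  have h2 := numCycles_swap_mul_of_not_sameCycle hbc
  omega

/-- If `f` has at most two cycles, then one of the two 3-cycles on `a`, `b`, `c` can be multiplied
to `f` without a change of the number of cycles. -/
lemma numCycles_swap_mul_swap_mul_eq_or (hab : a ≠ b) (hbc : b ≠ c) (h2 : numCycles f ≤ 2) :
    numCycles (swap b c * (swap a b * f)) = numCycles f ∨
      numCycles (swap a c * (swap b a * f)) = numCycles f := by
  by_cases h : f.SameCycle a b
  · by_cases h' : (swap a b * f).SameCycle b c
    · refine Or.inr (numCycles_swap_mul_swap_mul_of_sameCycle hab.symm h.symm fun h'' => ?_)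
      rw [swap_comm] at h''
      exact not_sameCycle_swap_mul hab h (h''.trans h'.symm)
    · exact Or.inl (numCycles_swap_mul_swap_mul_of_sameCycle hab h h')
  · exact Or.inl (numCycles_swap_mul_swap_mul_of_not_sameCycle hbc h2 h)

end cycles

/-! ### Positions along the cycles of a permutation -/

/-- A numbering of each cycle of `f` in cyclic order, starting from `0` at a root of the cycle. -/
structure IsPosition {X : Type*} (f : Perm X) (pos : X → ℕ) : Prop where
  apply_eq : ∀ x, pos (f x) = pos x + 1 ∨ pos (f x) = 0
  pow_apply : ∀ x y, f.SameCycle x y → pos x ≤ pos y → (f ^ (pos y - pos x)) x = y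
  card_root : Nat.card {x // pos x = 0} = numCycles f

lemma exists_isPosition {X : Type*} [Finite X] (f : Perm X) : ∃ pos, IsPosition f pos := by
  classical
  let root : X → X := fun x => (Quotient.mk (SameCycle.setoid f) x).out
  have hroot : ∀ x, f.SameCycle (root x) x := fun x =>
    Quotient.exact (s := SameCycle.setoid f) (Quotient.out_eq _)
  have hroot_eq : ∀ x y, f.SameCycle x y → root x = root y := fun x y h =>
    congrArg Quotient.out (Quotient.sound (s := SameCycle.setoid f) h)
  have hex : ∀ x, ∃ n, (f ^ n) (root x) = x := fun x => (hroot x).exists_nat_pow_eq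
  have hf : ∀ x, root (f x) = root x := fun x =>
    hroot_eq _ _ (sameCycle_apply_left.2 (SameCycle.refl f x))
  have hzero : ∀ x, Nat.find (hex x) = 0 ↔ root x = x := fun x => by simp
  refine ⟨fun x => Nat.find (hex x), fun x => ?_, fun x y hxy hle => ?_, ?_⟩
  · rcases hm : Nat.find (hex (f x)) with _ | m
    · exact Or.inr rfl
    · left
      have h1 := Nat.find_spec (hex (f x))
      rw [hm, hf, pow_succ', mul_apply, f.injective.eq_iff] at h1
      have h2 : Nat.find (hex (f x)) ≤ Nat.find (hex x) + 1 :=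
        Nat.find_min' _ (by rw [hf, pow_succ', mul_apply, Nat.find_spec (hex x)])
      have h3 : Nat.find (hex x) ≤ m := Nat.find_min' _ h1
      omega
  · have h : (f ^ Nat.find (hex y)) (root x) = y := by
      rw [hroot_eq _ _ hxy]
      exact Nat.find_spec (hex y)
    refine (congrArg _ (Nat.find_spec (hex x)).symm).trans ?_
    rw [← mul_apply, ← pow_add, Nat.sub_add_cancel hle, h]
  · refine Nat.card_congr (Equiv.ofBijective (fun x => Quotient.mk (SameCycle.setoid f) x.1)
      ⟨?_, ?_⟩)
    · rintro ⟨x, hx⟩ ⟨y, hy⟩ hxy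
      have hx := (hzero x).1 hx
      have hy := (hzero y).1 hy
      rw [Subtype.mk.injEq, ← hx, ← hy]
      exact congrArg Quotient.out hxy
    · intro q
      refine ⟨⟨q.out, (hzero _).2 ?_⟩, Quotient.out_eq q⟩
      exact congrArg Quotient.out (Quotient.out_eq q)

namespace IsPosition

variable {X : Type*} {f : Perm X} {pos : X → ℕ}

lemma injOn (hp : IsPosition f pos) {x y : X} (h : f.SameCycle x y) (he : pos x = pos y) :
    x = y := by
  have := hp.pow_apply x y h he.le
  rwa [he, Nat.sub_self, pow_zero, one_apply] at this

lemma pow_le (hp : IsPosition f pos) (n : ℕ) (x : X) : pos ((f ^ n) x) ≤ pos x + n := by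
  induction n with
  | zero => simp
  | succ n ih =>
    rw [pow_succ', mul_apply]
    rcases hp.apply_eq ((f ^ n) x) with h | h <;> omega

lemma pos_pow_apply (hp : IsPosition f pos) {x y : X} (h : f.SameCycle x y) {i : ℕ}
    (hi : pos x + i ≤ pos y) : pos ((f ^ i) x) = pos x + i := by
  have h1 := hp.pow_le i x
  have h2 := hp.pow_le (pos y - pos x - i) ((f ^ i) x)
  rw [← mul_apply, ← pow_add, Nat.sub_add_cancel (by omega),
    hp.pow_apply x y h (by omega)] at h2
  omega

/-- The element before a root is the last one of its cycle. -/
lemma le_of_apply_eq_zero (hp : IsPosition f pos) {x y : X} (h : f.SameCycle x y)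
    (hx : pos (f x) = 0) : pos y ≤ pos x := by
  by_contra! hlt
  have := hp.pos_pow_apply h (i := 1) (by omega)
  rw [pow_one] at this
  omega

/-- Along a cycle with `a`, `c`, `b` in this order, splitting at `a` and `b` separates `c` from
`b`. -/
lemma not_sameCycle_swap_mul [Finite X] [DecidableEq X] (hp : IsPosition f pos) {a b c : X}
    (hab : f.SameCycle a b) (hac : f.SameCycle a c) (h1 : pos a < pos c) (h2 : pos c < pos b) :
    ¬ (swap a b * f).SameCycle b c := by
  have key : ((swap a b * f) ^ (pos c - pos a)) a = (f ^ (pos c - pos a)) a := by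
    refine swap_mul_pow_apply fun i hi hi' => ?_
    have := hp.pos_pow_apply hac (i := i) (by omega)
    constructor <;> intro h <;> rw [h] at this <;> omega
  rw [hp.pow_apply a c hac h1.le] at key
  have hac' : (swap a b * f).SameCycle a c := ⟨(pos c - pos a : ℕ), by simpa using key⟩
  have hne : a ≠ b := by rintro rfl; omega
  exact fun h => CubicDecycling.not_sameCycle_swap_mul hne hab (hac'.trans h.symm)

end IsPosition

/-! ### Rotations at some of the vertices -/

/-- The reversal of the darts of a graph with edge type `ε`. -/
def dartFlip (ε : Type*) : Perm (ε × Bool) := (Equiv.refl ε).prodCongr Equiv.boolNot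

@[simp]
lemma dartFlip_apply {ε : Type*} (d : ε × Bool) : dartFlip ε d = (d.1, !d.2) := rfl

@[simp]
lemma dartFlip_dartFlip {ε : Type*} (d : ε × Bool) : dartFlip ε (dartFlip ε d) = d := by simp

/-- The permutation `σ` of the darts is a rotation at the vertices of `T`, where `src` gives the
sources of the darts: its restriction to the (at most three) darts at a vertex of `T` is a single
cycle, and it fixes the darts at the other vertices.  These darts are to be regarded as ending in
leaves of their own. -/
structure IsRotationOn {X W : Type*} (src : X → W) (T : Finset W) (σ : Perm X) : Prop where
  src_apply : ∀ d, src (σ d) = src d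
  apply_of_notMem : ∀ d, src d ∉ T → σ d = d
  eq_or_eq_or_eq : ∀ d d', src d ∈ T → src d' = src d → d' = d ∨ d' = σ d ∨ d' = σ (σ d)

namespace IsRotationOn

section

variable {X W : Type*} {src : X → W} {T : Finset W} {σ : Perm X}

lemma one (src : X → W) : IsRotationOn src ∅ 1 := by
  constructor <;> simp

variable [DecidableEq X]

lemma cycle_eq (h : IsRotationOn src T σ) {a : X} (ha : src a ∈ T)
    (h3 : {d | src d = src a}.ncard = 3) :
    σ (σ (σ a)) = a ∧ a ≠ σ a ∧ a ≠ σ (σ a) ∧ σ a ≠ σ (σ a) ∧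
      ∀ d, src d = src a ↔ d = a ∨ d = σ a ∨ d = σ (σ a) := by
  have hfib : ∀ d, src d = src a ↔ d = a ∨ d = σ a ∨ d = σ (σ a) := by
    refine fun d => ⟨h.eq_or_eq_or_eq a d ha, ?_⟩
    rintro (rfl | rfl | rfl) <;> simp [h.src_apply]
  have hset : {d | src d = src a} = ((({a, σ a, σ (σ a)} : Finset X)) : Set X) := by
    ext d
    simpa using hfib d
  rw [hset, Set.ncard_coe_finset] at h3
  have h12 : a ≠ σ a := by
    intro e
    rw [← e, ← e, Finset.insert_eq_of_mem (by simp), Finset.insert_eq_of_mem (by simp)] at h3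
    simp at h3
  have h13 : a ≠ σ (σ a) := by
    intro e
    have : ({a, σ a, σ (σ a)} : Finset X) = {a, σ a} := by
      rw [← e]
      ext
      simp [or_comm]
    rw [this] at h3
    have := Finset.card_le_two (a := a) (b := σ a)
    omega
  refine ⟨?_, h12, h13, fun e => h12 (σ.injective e), hfib⟩
  rcases (hfib (σ (σ (σ a)))).1 (by simp [h.src_apply]) with e | e | e
  · exact e
  · exact absurd (σ.injective e).symm h13
  · exact absurd (σ.injective (σ.injective e)).symm h12

variable [DecidableEq W]

lemma insert (h : IsRotationOn src T σ) {v : W} (hv : v ∉ T) {a b c : X}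
    (hab : a ≠ b) (hac : a ≠ c) (hbc : b ≠ c) (hfib : ∀ d, src d = v ↔ d = a ∨ d = b ∨ d = c) :
    IsRotationOn src (Insert.insert v T) (swap b c * (swap a b * σ)) := by
  have ha : src a = v := (hfib a).2 (by simp)
  have hb : src b = v := (hfib b).2 (by simp)
  have hc : src c = v := (hfib c).2 (by simp)
  have fa : σ a = a := h.apply_of_notMem a (by rwa [ha])
  have fb : σ b = b := h.apply_of_notMem b (by rwa [hb])
  have fc : σ c = c := h.apply_of_notMem c (by rwa [hc])
  have ga : (swap b c * (swap a b * σ)) a = c := by simp [fa]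
  have gb : (swap b c * (swap a b * σ)) b = a := by
    simp [fb, swap_apply_of_ne_of_ne hab hac]
  have gc : (swap b c * (swap a b * σ)) c = b := by
    simp [fc, swap_apply_of_ne_of_ne hac.symm hbc.symm]
  have gd : ∀ d, src d ≠ v → (swap b c * (swap a b * σ)) d = σ d := by
    intro d hd
    rw [← h.src_apply d, Ne, hfib] at hd
    push Not at hd
    simp [swap_apply_of_ne_of_ne hd.1 hd.2.1, swap_apply_of_ne_of_ne hd.2.1 hd.2.2]
  refine ⟨fun d => ?_, fun d hd => ?_, fun d d' hd hd' => ?_⟩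
  · by_cases hd : src d = v
    · rcases (hfib d).1 hd with rfl | rfl | rfl
      · rw [ga, ha, hc]
      · rw [gb, ha, hb]
      · rw [gc, hb, hc]
    · rw [gd d hd, h.src_apply]
  · rw [Finset.mem_insert, not_or] at hd
    rw [gd d hd.1, h.apply_of_notMem d hd.2]
  · by_cases hdv : src d = v
    · rw [hdv] at hd'
      rcases (hfib d).1 hdv with rfl | rfl | rfl <;> rcases (hfib d').1 hd' with rfl | rfl | rfl <;>
        simp only [ga, gb, gc, true_or, or_true]
    · rw [gd d hdv, gd (σ d) (by rwa [h.src_apply])]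
      exact h.eq_or_eq_or_eq d d' (Finset.mem_of_mem_insert_of_ne hd hdv) hd'

lemma erase (h : IsRotationOn src T σ) {a : X} (ha : src a ∈ T)
    (h3 : {d | src d = src a}.ncard = 3) :
    IsRotationOn src (T.erase (src a))
      (swap (σ a) (σ (σ a)) * (swap a (σ a) * σ)) := by
  obtain ⟨h0, hab, hac, hbc, hfib⟩ := h.cycle_eq ha h3
  have ga : (swap (σ a) (σ (σ a)) * (swap a (σ a) * σ)) a = a := by
    simp [swap_apply_of_ne_of_ne hab hac]
  have gb : (swap (σ a) (σ (σ a)) * (swap a (σ a) * σ)) (σ a) = σ a := by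
    simp [swap_apply_of_ne_of_ne hac.symm hbc.symm]
  have gc : (swap (σ a) (σ (σ a)) * (swap a (σ a) * σ)) (σ (σ a)) = σ (σ a) := by
    simp [h0]
  have g1 : ∀ d, src d = src a → (swap (σ a) (σ (σ a)) * (swap a (σ a) * σ)) d = d := by
    intro d hd
    rcases (hfib d).1 hd with rfl | rfl | rfl
    exacts [ga, gb, gc]
  have gd : ∀ d, src d ≠ src a → (swap (σ a) (σ (σ a)) * (swap a (σ a) * σ)) d = σ d := by
    intro d hd
    rw [← h.src_apply d, Ne, hfib] at hd
    push Not at hd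
    rw [mul_apply, mul_apply, swap_apply_of_ne_of_ne hd.1 hd.2.1,
      swap_apply_of_ne_of_ne hd.2.1 hd.2.2]
  refine ⟨fun d => ?_, fun d hd => ?_, fun d d' hd hd' => ?_⟩
  · by_cases hd : src d = src a
    · rw [g1 d hd]
    · rw [gd d hd, h.src_apply]
  · by_cases hd' : src d = src a
    · exact g1 d hd'
    · rw [gd d hd', h.apply_of_notMem d fun hT => hd (Finset.mem_erase.2 ⟨hd', hT⟩)]
  · obtain ⟨hdv, hd⟩ := Finset.mem_erase.1 hd
    rw [gd d hdv, gd (σ d) (by rwa [h.src_apply])]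
    exact h.eq_or_eq_or_eq d d' hd hd'

end

end IsRotationOn

/-! ### The components of the darts -/

section dartSetoid

variable {ε W : Type*} {src : ε × Bool → W} {T : Finset W}

/-- Two darts are equivalent if they lie in the same component of the graph that results when all
vertices outside `T` are split into leaves. -/
def dartSetoid (src : ε × Bool → W) (T : Finset W) : Setoid (ε × Bool) :=
  Relation.EqvGen.setoid fun d d' => d' = dartFlip ε d ∨ (src d = src d' ∧ src d ∈ T)

lemma dartSetoid_le {t : Setoid (ε × Bool)} (h1 : ∀ d, t d (dartFlip ε d))
    (h2 : ∀ d d', src d = src d' → src d ∈ T → t d d') : dartSetoid src T ≤ t := by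
  refine Setoid.eqvGen_le ?_
  rintro d d' (rfl | ⟨h, h'⟩)
  exacts [h1 d, h2 d d' h h']

lemma dartSetoid_flip (d : ε × Bool) : dartSetoid src T d (dartFlip ε d) :=
  Relation.EqvGen.rel _ _ (Or.inl rfl)

lemma dartSetoid_of_src_eq {d d' : ε × Bool} (h : src d = src d') (h' : src d ∈ T) :
    dartSetoid src T d d' :=
  Relation.EqvGen.rel _ _ (Or.inr ⟨h, h'⟩)

lemma IsRotationOn.setoid_sameCycle_le {σ : Perm (ε × Bool)} (h : IsRotationOn src T σ) :
    SameCycle.setoid (σ * dartFlip ε) ≤ dartSetoid src T := by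
  refine CubicDecycling.setoid_sameCycle_le fun d => ?_
  rw [mul_apply]
  refine (dartSetoid src T).trans (dartSetoid_flip d) ?_
  by_cases hd : src (dartFlip ε d) ∈ T
  · exact dartSetoid_of_src_eq (h.src_apply _).symm hd
  · rw [h.apply_of_notMem _ hd]

lemma card_dartSetoid_empty (src : ε × Bool → W) :
    Nat.card (Quotient (dartSetoid src ∅)) = Nat.card ε := by
  have hle : dartSetoid src ∅ ≤ Setoid.ker Prod.fst :=
    dartSetoid_le (fun d => rfl) (by simp)
  refine Nat.card_congr (Equiv.ofBijective (Quotient.lift Prod.fst fun _ _ h => hle h) ⟨?_, ?_⟩)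
  · intro p q
    induction p using Quotient.inductionOn with | _ x
    induction q using Quotient.inductionOn with | _ y
    obtain ⟨e, b⟩ := x
    obtain ⟨e', b'⟩ := y
    intro h
    obtain rfl : e = e' := h
    refine Quotient.sound ?_
    by_cases hb : b = b'
    · subst hb
      exact (dartSetoid src ∅).refl _
    · have : ((e, b') : ε × Bool) = dartFlip ε (e, b) := by
        rw [dartFlip_apply, Prod.mk.injEq]
        exact ⟨rfl, by revert hb; cases b <;> cases b' <;> simp⟩
      rw [this]
      exact dartSetoid_flip _
  · exact fun e => ⟨Quotient.mk _ (e, true), rfl⟩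

variable [DecidableEq W]

lemma dartSetoid_insert {v : W} {a b c : ε × Bool}
    (hfib : ∀ d, src d = v ↔ d = a ∨ d = b ∨ d = c) :
    dartSetoid src (insert v T) = glue (glue (dartSetoid src T) a b) b c := by
  have ha : src a = v := (hfib a).2 (by simp)
  have hb : src b = v := (hfib b).2 (by simp)
  have hc : src c = v := (hfib c).2 (by simp)
  apply le_antisymm
  · set t := glue (glue (dartSetoid src T) a b) b c
    have hle : dartSetoid src T ≤ t := le_glue.trans le_glue
    have hab : t a b := le_glue glue_pair
    have hbc : t b c := glue_pair
    refine dartSetoid_le (fun d => hle (dartSetoid_flip d)) fun d d' h h' => ?_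
    by_cases hd : src d = v
    · have key : ∀ d, src d = v → t b d := by
        intro d hd
        rcases (hfib d).1 hd with rfl | rfl | rfl
        exacts [t.symm hab, t.refl _, hbc]
      exact t.trans (t.symm (key d hd)) (key d' (h ▸ hd))
    · exact hle (dartSetoid_of_src_eq h (Finset.mem_of_mem_insert_of_ne h' hd))
  · refine glue_le (glue_le (dartSetoid_le dartSetoid_flip fun d d' h h' =>
      dartSetoid_of_src_eq h (Finset.mem_insert_of_mem h')) ?_) ?_
    · exact dartSetoid_of_src_eq (ha.trans hb.symm) (by simp [ha])
    · exact dartSetoid_of_src_eq (hb.trans hc.symm) (by simp [hb])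

variable [Finite ε]

lemma card_dartSetoid_le_insert {v : W} (h3 : {d | src d = v}.ncard = 3) :
    Nat.card (Quotient (dartSetoid src T)) ≤
      Nat.card (Quotient (dartSetoid src (insert v T))) + 2 := by
  obtain ⟨a, b, c, -, -, -, hs⟩ := Set.ncard_eq_three.1 h3
  rw [dartSetoid_insert (a := a) (b := b) (c := c) fun d => by simpa using Set.ext_iff.1 hs d]
  have h1 := card_quotient_le_card_glue_add_one (dartSetoid src T) a b
  have h2 := card_quotient_le_card_glue_add_one (glue (dartSetoid src T) a b) b c
  omega

/-- Adding a vertex merges at most three components, so that `components + 2 * vertices` does not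
decrease. -/
lemma card_dartSetoid_add_two_mul_card_mono (h3 : ∀ v, {d | src d = v}.ncard = 3)
    {T' : Finset W} (h : T ⊆ T') :
    Nat.card (Quotient (dartSetoid src T)) + 2 * T.card ≤
      Nat.card (Quotient (dartSetoid src T')) + 2 * T'.card := by
  rw [← Finset.union_eq_right.2 h]
  generalize T' = U
  induction U using Finset.induction_on with
  | empty => simp
  | insert v U _ ih =>
    rw [Finset.union_insert]
    by_cases hv : v ∈ T ∪ U
    · rwa [Finset.insert_eq_of_mem hv]
    · have := card_dartSetoid_le_insert (T := T ∪ U) (h3 v)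
      rw [Finset.card_insert_of_notMem hv]
      omega

lemma card_le_card_dartSetoid_add_two_mul_card (h3 : ∀ v, {d | src d = v}.ncard = 3)
    (T : Finset W) : Nat.card ε ≤ Nat.card (Quotient (dartSetoid src T)) + 2 * T.card := by
  have := card_dartSetoid_add_two_mul_card_mono h3 (Finset.empty_subset T)
  rwa [card_dartSetoid_empty, Finset.card_empty, mul_zero, add_zero] at this

end dartSetoid

/-! ### Rotations with few faces -/

section existence

variable {ε W : Type*} {src : ε × Bool → W} [DecidableEq W] [DecidableEq ε] [Finite ε]

/-- If every vertex of `S` merges three components, then each component has one face, whatever the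
rotations at the vertices of `S` are. -/
lemma exists_isRotationOn_numCycles_eq_card_dartSetoid (h3 : ∀ v, {d | src d = v}.ncard = 3)
    {S : Finset W} (hS : Nat.card (Quotient (dartSetoid src S)) + 2 * S.card = Nat.card ε) :
    ∃ σ, IsRotationOn src S σ ∧
      numCycles (σ * dartFlip ε) = Nat.card (Quotient (dartSetoid src S)) := by
  suffices H : ∀ T ⊆ S, ∃ σ, IsRotationOn src T σ ∧
      numCycles (σ * dartFlip ε) = Nat.card (Quotient (dartSetoid src T)) from H S le_rfl
  intro T
  induction T using Finset.induction_on with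
  | empty =>
    refine fun _ => ⟨1, IsRotationOn.one src, ?_⟩
    have hle := (IsRotationOn.one src).setoid_sameCycle_le
    rw [numCycles, le_antisymm hle (dartSetoid_le (fun d => ?_) (by simp))]
    exact ⟨1, by simp⟩
  | insert v T hv ih =>
    intro hT
    obtain ⟨σ, hσ, hcard⟩ := ih ((Finset.subset_insert v T).trans hT)
    obtain ⟨a, b, c, hab, hac, hbc, hs⟩ := Set.ncard_eq_three.1 (h3 v)
    have hfib : ∀ d, src d = v ↔ d = a ∨ d = b ∨ d = c := fun d => by simpa using Set.ext_iff.1 hs d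
    refine ⟨_, hσ.insert hv hab hac hbc hfib, ?_⟩
    have h1 := card_dartSetoid_add_two_mul_card_mono h3 hT
    have h2 := card_le_card_dartSetoid_add_two_mul_card h3 T
    rw [Finset.card_insert_of_notMem hv] at h1
    have h4 := dartSetoid_insert (T := T) hfib
    set r := dartSetoid src T
    have h5 := card_quotient_le_card_glue_add_one r a b
    have h6 := card_quotient_le_card_glue_add_one (glue r a b) b c
    rw [h4] at h1 ⊢
    have nab : ¬ r a b := fun h => by
      rw [glue_eq_self h] at h1 h6
      omega
    have nbc : ¬ glue r a b b c := fun h => by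
      rw [glue_eq_self h] at h1
      omega
    have hle := hσ.setoid_sameCycle_le
    have nab' : ¬ (σ * dartFlip ε).SameCycle a b := fun h => nab (hle h)
    have nbc' : ¬ (swap a b * (σ * dartFlip ε)).SameCycle b c := fun h =>
      nbc ((setoid_swap_mul_le _ a b).trans (glue_le (hle.trans le_glue) glue_pair) h)
    have h7 := numCycles_swap_mul_of_not_sameCycle nab'
    have h8 := numCycles_swap_mul_of_not_sameCycle nbc'
    rw [mul_assoc, mul_assoc]
    omega

/-- A rotation with at most two faces extends to further vertices without a change of the number of
faces. -/
lemma IsRotationOn.exists_extension (h3 : ∀ v, {d | src d = v}.ncard = 3) {S : Finset W}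
    {σ : Perm (ε × Bool)} (hσ : IsRotationOn src S σ) (h2 : numCycles (σ * dartFlip ε) ≤ 2)
    (U : Finset W) :
    ∃ σ', IsRotationOn src (U ∪ S) σ' ∧
      numCycles (σ' * dartFlip ε) = numCycles (σ * dartFlip ε) := by
  induction U using Finset.induction_on with
  | empty => exact ⟨σ, by rwa [Finset.empty_union], rfl⟩
  | insert v U _ ih =>
    obtain ⟨τ, hτ, hcard⟩ := ih
    rw [Finset.insert_union]
    by_cases hv : v ∈ U ∪ S
    · exact ⟨τ, by rwa [Finset.insert_eq_of_mem hv], hcard⟩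
    · obtain ⟨a, b, c, hab, hac, hbc, hs⟩ := Set.ncard_eq_three.1 (h3 v)
      have hfib : ∀ d, src d = v ↔ d = a ∨ d = b ∨ d = c := fun d => by
        simpa using Set.ext_iff.1 hs d
      rcases numCycles_swap_mul_swap_mul_eq_or (f := τ * dartFlip ε) hab hbc (hcard.trans_le h2)
        with h | h
      · exact ⟨_, hτ.insert hv hab hac hbc hfib, by rw [mul_assoc, mul_assoc, h, hcard]⟩
      · refine ⟨_, hτ.insert hv hab.symm hbc hac fun d => (hfib d).trans ?_,
          by rw [mul_assoc, mul_assoc, h, hcard]⟩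
        tauto

end existence

/-! ### Erasing vertices from a rotation -/

section erasing

variable {ε W : Type*} {src : ε × Bool → W} {S : Finset W} {σ : Perm (ε × Bool)}
  {pos : ε × Bool → ℕ}

/-- If the faces are preserved by the reversal of darts, then every edge `{d, d'}` with
`pos d' < pos d` gives a weak descent of `σ` at `d`, because `σ d` is the successor of `d'` on the
face or the root.  Every face gives one more, at the dart that `σ` maps to the root. -/
lemma le_card_filter_descent [DecidableEq ε] [Fintype ε] (hp : IsPosition (σ * dartFlip ε) pos)
    (hflip : ∀ d, (σ * dartFlip ε).SameCycle d (dartFlip ε d)) :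
    Fintype.card ε + numCycles (σ * dartFlip ε) ≤
      (Finset.univ.filter fun d => pos (σ d) ≤ pos d).card := by
  have hfσ : ∀ d, (σ * dartFlip ε) (dartFlip ε d) = σ d := fun d => by
    rw [mul_apply, dartFlip_dartFlip]
  have hne : ∀ d, pos (dartFlip ε d) ≠ pos d := by
    intro d h
    have := hp.injOn (hflip d).symm h
    simp [Prod.ext_iff] at this
  -- `g e` is the dart of `e` with the larger position.
  let g : ε → ε × Bool := fun e => (e, decide (pos (e, false) < pos (e, true)))
  have hg : ∀ e, pos (dartFlip ε (g e)) < pos (g e) := by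
    intro e
    by_cases h : pos (e, false) < pos (e, true)
    · simp [g, h]
    · have := hne (e, false)
      simp only [dartFlip_apply, Bool.not_false] at this
      simp only [g, h, decide_false, dartFlip_apply, Bool.not_false]
      omega
  have hginj : Function.Injective g := fun e e' h => congrArg Prod.fst h
  have hroot : (Finset.univ.filter fun d => pos (σ d) = 0).card = numCycles (σ * dartFlip ε) := by
    rw [← hp.card_root, ← Fintype.card_subtype, ← Nat.card_eq_fintype_card]
    exact Nat.card_congr (σ.subtypeEquiv fun d => Iff.rfl)
  rw [← hroot, ← Finset.card_univ (α := ε), ← Finset.card_image_of_injective _ hginj,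
    ← Finset.card_union_of_disjoint]
  · refine Finset.card_le_card fun d hd => ?_
    rw [Finset.mem_filter]
    refine ⟨Finset.mem_univ _, ?_⟩
    rcases Finset.mem_union.1 hd with hd | hd
    · obtain ⟨e, -, rfl⟩ := Finset.mem_image.1 hd
      have := hg e
      rcases hp.apply_eq (dartFlip ε (g e)) with h | h <;> rw [hfσ] at h <;> omega
    · rw [(Finset.mem_filter.1 hd).2]
      exact Nat.zero_le _
  · rw [Finset.disjoint_left]
    intro d hd hd'
    obtain ⟨e, -, rfl⟩ := Finset.mem_image.1 hd
    have h0 := (Finset.mem_filter.1 hd').2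
    rw [← hfσ] at h0
    exact (hg e).not_ge (hp.le_of_apply_eq_zero (hflip _).symm h0)

variable [DecidableEq W] [DecidableEq ε]

/-- If no vertex can be erased from a rotation with at most two faces without a change of the number
of faces, then no vertex meets two faces. -/
lemma IsRotationOn.sameCycle_of_src_eq [Finite ε] (h3 : ∀ v, {d | src d = v}.ncard = 3)
    (hσ : IsRotationOn src S σ) (h2 : numCycles (σ * dartFlip ε) ≤ 2)
    (hmin : ∀ v ∈ S, ∀ τ, IsRotationOn src (S.erase v) τ →
      numCycles (τ * dartFlip ε) ≠ numCycles (σ * dartFlip ε))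
    {d d' : ε × Bool} (h : src d = src d') (hd : src d ∈ S) :
    (σ * dartFlip ε).SameCycle d d' := by
  have key : ∀ a, src a ∈ S → (σ * dartFlip ε).SameCycle a (σ a) := by
    intro a ha
    by_contra hab
    obtain ⟨-, -, -, hbc, -⟩ := hσ.cycle_eq ha (h3 _)
    refine hmin _ ha _ (hσ.erase ha (h3 _)) ?_
    rw [mul_assoc, mul_assoc]
    exact numCycles_swap_mul_swap_mul_of_not_sameCycle hbc h2 hab
  have h1 := key d hd
  have h2 := key (σ d) (by rwa [hσ.src_apply])
  rcases hσ.eq_or_eq_or_eq d d' hd h.symm with rfl | rfl | rfl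
  exacts [SameCycle.refl _ _, h1, h1.trans h2]

/-- If every vertex of `S` lies on one face only and none can be erased, then the rotation at each
vertex of `S` agrees with the order along the face, and so it descends only when it returns to the
first dart. -/
lemma IsRotationOn.card_filter_descent_le_one [Fintype ε] (h3 : ∀ v, {d | src d = v}.ncard = 3)
    (hσ : IsRotationOn src S σ) (hp : IsPosition (σ * dartFlip ε) pos)
    (hmin : ∀ v ∈ S, ∀ τ, IsRotationOn src (S.erase v) τ →
      numCycles (τ * dartFlip ε) ≠ numCycles (σ * dartFlip ε))
    (hsame : ∀ d d', src d = src d' → src d ∈ S → (σ * dartFlip ε).SameCycle d d')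
    {v : W} (hv : v ∈ S) :
    ((Finset.univ.filter fun d => pos (σ d) ≤ pos d).filter fun d => src d = v).card ≤ 1 := by
  obtain ⟨x, y, z, -, -, -, hs⟩ := Set.ncard_eq_three.1 (h3 v)
  have hne : (Finset.univ.filter fun d => src d = v).Nonempty :=
    ⟨x, by have := Set.ext_iff.1 hs x; simpa using this⟩
  obtain ⟨a, ha, hamin⟩ := Finset.exists_min_image _ pos hne
  simp only [Finset.mem_filter, Finset.mem_univ, true_and] at ha hamin
  subst ha
  obtain ⟨h0, hab, hac, hbc, hfib⟩ := hσ.cycle_eq hv (h3 _)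
  have sab := hsame a (σ a) (hσ.src_apply a).symm hv
  have sac := hsame a (σ (σ a)) (by rw [hσ.src_apply, hσ.src_apply]) hv
  have lab : pos a < pos (σ a) := lt_of_le_of_ne (hamin _ (hσ.src_apply a))
    fun h => hab (hp.injOn sab h)
  have lac : pos a < pos (σ (σ a)) := lt_of_le_of_ne
    (hamin _ (by rw [hσ.src_apply, hσ.src_apply])) fun h => hac (hp.injOn sac h)
  have lbc : pos (σ a) < pos (σ (σ a)) := by
    refine lt_of_le_of_ne ?_ fun h => hbc (hp.injOn (sab.symm.trans sac) h)
    -- If the face meets the darts in the order `a`, `σ (σ a)`, `σ a`, then it can be erased.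
    by_contra! hlt
    refine hmin _ hv _ (hσ.erase hv (h3 _)) ?_
    rw [mul_assoc, mul_assoc]
    exact numCycles_swap_mul_swap_mul_of_sameCycle hab sab
      (hp.not_sameCycle_swap_mul sab sac lac hlt)
  refine (Finset.card_le_card (t := {σ (σ a)}) fun d hd => ?_).trans (Finset.card_singleton _).le
  simp only [Finset.mem_filter, Finset.mem_univ, true_and] at hd
  rcases (hfib d).1 hd.2 with rfl | rfl | rfl
  · omega
  · omega
  · exact Finset.mem_singleton_self _

/-- Vertices of a rotation with one or two faces can be erased, without a change of the number of
faces, until only a spanning forest of one-faced components is left. -/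
lemma IsRotationOn.exists_card_dartSetoid_eq [Fintype ε] [Fintype W]
    (h3 : ∀ v, {d | src d = v}.ncard = 3) (hσ : IsRotationOn src Finset.univ σ)
    (h2 : numCycles (σ * dartFlip ε) ≤ 2) :
    ∃ S : Finset W, Nat.card (Quotient (dartSetoid src S)) = numCycles (σ * dartFlip ε) ∧
      Nat.card (Quotient (dartSetoid src S)) + 2 * S.card = Nat.card ε := by
  have hex : ∃ n, ∃ (S : Finset W) (τ : Perm (ε × Bool)), IsRotationOn src S τ ∧
      numCycles (τ * dartFlip ε) = numCycles (σ * dartFlip ε) ∧ S.card = n :=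
    ⟨_, _, σ, hσ, rfl, rfl⟩
  classical
  obtain ⟨S, τ, hτ, hcard, hS⟩ := Nat.find_spec hex
  have hmin : ∀ v ∈ S, ∀ τ', IsRotationOn src (S.erase v) τ' →
      numCycles (τ' * dartFlip ε) ≠ numCycles (τ * dartFlip ε) := fun v hv τ' hτ' h =>
    Nat.find_min hex (m := (S.erase v).card) (by rw [← hS]; exact Finset.card_erase_lt_of_mem hv)
      ⟨_, τ', hτ', h.trans hcard, rfl⟩
  rw [← hcard] at h2 ⊢
  have hsame : ∀ d d', src d = src d' → src d ∈ S → (τ * dartFlip ε).SameCycle d d' :=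
    fun d d' => hτ.sameCycle_of_src_eq h3 h2 hmin
  have hflip : ∀ d, (τ * dartFlip ε).SameCycle d (dartFlip ε d) := by
    intro d
    have h1 : (τ * dartFlip ε).SameCycle d (τ (dartFlip ε d)) := ⟨1, by simp⟩
    by_cases hd : src (dartFlip ε d) ∈ S
    · exact h1.trans (hsame _ _ (hτ.src_apply _) (by rwa [hτ.src_apply]))
    · rwa [hτ.apply_of_notMem _ hd] at h1
  have heq : dartSetoid src S = SameCycle.setoid (τ * dartFlip ε) :=
    le_antisymm (dartSetoid_le hflip hsame) hτ.setoid_sameCycle_le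
  have hk : Nat.card (Quotient (dartSetoid src S)) = numCycles (τ * dartFlip ε) := by
    rw [heq, numCycles]
  refine ⟨S, hk, le_antisymm ?_ (card_le_card_dartSetoid_add_two_mul_card h3 S)⟩
  obtain ⟨pos, hp⟩ := exists_isPosition (τ * dartFlip ε)
  have hlow := le_card_filter_descent hp hflip
  rw [Finset.card_eq_sum_card_fiberwise (t := Finset.univ) (f := src) fun _ _ => by simp] at hlow
  have hfib : ∀ v, (Finset.univ.filter fun d => src d = v).card = 3 := by
    intro v
    rw [← h3 v, ← Set.ncard_coe_finset]
    simp
  have hdarts : 2 * Fintype.card ε = 3 * Fintype.card W := by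
    have h := Finset.card_eq_sum_card_fiberwise (s := (Finset.univ : Finset (ε × Bool)))
      (t := Finset.univ) (f := src) fun _ _ => by simp
    simp only [hfib, Finset.card_univ, Fintype.card_prod, Fintype.card_bool, Finset.sum_const,
      smul_eq_mul] at h
    omega
  have hup : ∀ v ∈ (Finset.univ : Finset W),
      ((Finset.univ.filter fun d => pos (τ d) ≤ pos d).filter fun d => src d = v).card +
        (if v ∈ S then 2 else 0) ≤ 3 := by
    intro v _
    split_ifs with hv
    · have := hτ.card_filter_descent_le_one h3 hp hmin hsame hv
      omega
    · rw [← hfib v]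
      exact Finset.card_le_card (Finset.filter_subset_filter _ (Finset.filter_subset _ _))
  have hsum := Finset.sum_le_sum hup
  rw [Finset.sum_add_distrib, Finset.sum_ite_mem, Finset.univ_inter, Finset.sum_const,
    Finset.sum_const, Finset.card_univ, smul_eq_mul, smul_eq_mul] at hsum
  rw [hk, Nat.card_eq_fintype_card]
  omega

end erasing

/-! ### Forests and the number of components -/

section simpleGraph

variable {V : Type*}

lemma reachableSetoid_eq_glue_deleteEdges {H : SimpleGraph V} {a b : V} (hab : H.Adj a b) :
    H.reachableSetoid = glue (H.deleteEdges {s(a, b)}).reachableSetoid a b := by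
  apply le_antisymm
  · set t := glue (H.deleteEdges {s(a, b)}).reachableSetoid a b with ht
    rintro x y ⟨p⟩
    induction p with
    | nil => exact t.refl _
    | @cons u v w h p ih =>
      refine t.trans ?_ ih
      by_cases he : s(u, v) = s(a, b)
      · rcases Sym2.eq_iff.1 he with ⟨rfl, rfl⟩ | ⟨rfl, rfl⟩
        · exact glue_pair
        · exact t.symm glue_pair
      · refine le_glue (SimpleGraph.Adj.reachable ?_)
        rw [SimpleGraph.deleteEdges_adj]
        exact ⟨h, he⟩
  · exact glue_le (fun _ _ h => SimpleGraph.Reachable.mono (SimpleGraph.deleteEdges_le _) h)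
      hab.reachable

lemma card_edgeSet_deleteEdges_add_one [Finite V] {H : SimpleGraph V} {a b : V}
    (hab : H.Adj a b) :
    Nat.card (H.deleteEdges {s(a, b)}).edgeSet + 1 = Nat.card H.edgeSet := by
  rw [SimpleGraph.edgeSet_deleteEdges, Nat.card_coe_set_eq, Nat.card_coe_set_eq]
  exact Set.ncard_sdiff_singleton_add_one hab (Set.toFinite _)

lemma card_vert_le_card_edgeSet_add_card_connectedComponent [Finite V] (H : SimpleGraph V) :
    Nat.card V ≤ Nat.card H.edgeSet + Nat.card H.ConnectedComponent := by
  obtain ⟨n, hn⟩ : ∃ n, Nat.card H.edgeSet = n := ⟨_, rfl⟩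
  induction n generalizing H with
  | zero =>
    have hbot : H = ⊥ := by
      rw [← SimpleGraph.edgeSet_eq_empty, ← Set.isEmpty_coe_sort]
      exact (Finite.card_eq_zero_iff).1 hn
    subst hbot
    have hinj : Function.Injective (⊥ : SimpleGraph V).connectedComponentMk := fun x y h =>
      SimpleGraph.reachable_bot.1 (SimpleGraph.ConnectedComponent.exact h)
    have := Nat.card_le_card_of_injective _ hinj
    omega
  | succ n ih =>
    have hne : Nonempty H.edgeSet := by
      by_contra h
      rw [not_nonempty_iff] at h
      rw [Nat.card_of_isEmpty] at hn
      omega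
    obtain ⟨⟨e, he⟩⟩ := hne
    induction e using Sym2.ind with | _ a b
    have he : H.Adj a b := he
    have h1 := card_edgeSet_deleteEdges_add_one he
    have h2 := ih (H.deleteEdges {s(a, b)}) (by omega)
    have h3 := card_quotient_le_card_glue_add_one (H.deleteEdges {s(a, b)}).reachableSetoid a b
    rw [← reachableSetoid_eq_glue_deleteEdges he] at h3
    change Nat.card (H.deleteEdges {s(a, b)}).ConnectedComponent ≤
      Nat.card H.ConnectedComponent + 1 at h3
    omega

lemma isAcyclic_iff_card_vert_eq [Finite V] (H : SimpleGraph V) :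
    H.IsAcyclic ↔ Nat.card V = Nat.card H.edgeSet + Nat.card H.ConnectedComponent := by
  constructor
  · intro hH
    obtain ⟨n, hn⟩ : ∃ n, Nat.card H.edgeSet = n := ⟨_, rfl⟩
    induction n generalizing H with
    | zero =>
      have h1 := card_vert_le_card_edgeSet_add_card_connectedComponent H
      have h2 := Nat.card_le_card_of_surjective H.connectedComponentMk Quot.mk_surjective
      omega
    | succ n ih =>
      have hne : Nonempty H.edgeSet := by
        by_contra h
        rw [not_nonempty_iff] at h
        rw [Nat.card_of_isEmpty] at hn
        omega
      obtain ⟨⟨e, he⟩⟩ := hne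
      induction e using Sym2.ind with | _ a b
      have he : H.Adj a b := he
      have h1 := card_edgeSet_deleteEdges_add_one he
      have h2 := ih (H.deleteEdges {s(a, b)}) (hH.anti (SimpleGraph.deleteEdges_le _)) (by omega)
      have hbr := SimpleGraph.isBridge_iff.1 (SimpleGraph.isAcyclic_iff_forall_isBridge.1 hH he)
      have h3 := card_quotient_eq_card_glue_add_one
        (r := (H.deleteEdges {s(a, b)}).reachableSetoid) hbr
      rw [← reachableSetoid_eq_glue_deleteEdges he] at h3
      change Nat.card (H.deleteEdges {s(a, b)}).ConnectedComponent =
        Nat.card H.ConnectedComponent + 1 at h3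
      omega
  · intro h
    rw [SimpleGraph.isAcyclic_iff_forall_isBridge]
    intro e he
    induction e using Sym2.ind with | _ a b
    have he : H.Adj a b := he
    rw [SimpleGraph.isBridge_iff]
    intro hr
    have h1 := card_edgeSet_deleteEdges_add_one he
    have h2 := card_vert_le_card_edgeSet_add_card_connectedComponent (H.deleteEdges {s(a, b)})
    have h3 := reachableSetoid_eq_glue_deleteEdges he
    rw [glue_eq_self hr] at h3
    have h4 : Nat.card H.ConnectedComponent =
        Nat.card (H.deleteEdges {s(a, b)}).ConnectedComponent :=
      congrArg (fun r : Setoid V => Nat.card (Quotient r)) h3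
    omega

end simpleGraph

section multigraph

variable {α : Type*} {β : Type*}

/-- A finite multigraph is a forest if and only if its numbers of edges and components add up to the
number of vertices: any surplus edge closes a cycle, possibly of length one or two. -/
lemma isForest_iff_ncard_eq (H : Graph α β) (hV : V(H).Finite) (hE : E(H).Finite) :
    IsForest H ↔ V(H).ncard = E(H).ncard + numComponents H := by
  have : Finite V(H) := hV
  have : Finite E(H) := hE
  have hex : ∀ s : H.toSimpleGraph.edgeSet, ∃ e : E(H), ∃ x y : V(H), s.1 = s(x, y) ∧
      H.IsLink e x y := by
    rintro ⟨s, hs⟩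
    induction s using Sym2.ind with | _ x y
    obtain ⟨e, he⟩ := (show H.toSimpleGraph.Adj x y from hs).2
    exact ⟨⟨e, he.edge_mem⟩, x, y, rfl, he⟩
  choose f fx fy hf1 hf2 using hex
  have hinj : Function.Injective f := by
    intro s t hst
    have hs := hf2 s
    rw [hst] at hs
    rw [Subtype.ext_iff, hf1, hf1]
    rcases hs.eq_and_eq_or_eq_and_eq (hf2 t) with ⟨h1, h2⟩ | ⟨h1, h2⟩
    · rw [Subtype.ext h1, Subtype.ext h2]
    · rw [Subtype.ext h1, Subtype.ext h2, Sym2.eq_swap]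
  have hle := Nat.card_le_card_of_injective f hinj
  have hsimple : H.Simple ↔ Nat.card H.toSimpleGraph.edgeSet = Nat.card E(H) := by
    constructor
    · intro hs
      refine le_antisymm hle (Nat.card_le_card_of_surjective f ?_)
      rintro ⟨e, he⟩
      obtain ⟨x, y, hxy⟩ := Graph.exists_isLink_of_mem_edgeSet he
      have hadj : H.toSimpleGraph.Adj ⟨x, hxy.left_mem⟩ ⟨y, hxy.right_mem⟩ :=
        ⟨fun h => hxy.ne (congrArg Subtype.val h), e, hxy⟩
      refine ⟨⟨s(⟨x, hxy.left_mem⟩, ⟨y, hxy.right_mem⟩), hadj⟩, Subtype.ext ?_⟩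
      have h1 := hf1 ⟨s(⟨x, hxy.left_mem⟩, ⟨y, hxy.right_mem⟩), hadj⟩
      have h2 := hf2 ⟨s(⟨x, hxy.left_mem⟩, ⟨y, hxy.right_mem⟩), hadj⟩
      rcases Sym2.eq_iff.1 h1 with ⟨h3, h4⟩ | ⟨h3, h4⟩
      · rw [← h3, ← h4] at h2
        exact h2.eq hxy
      · rw [← h3, ← h4] at h2
        exact h2.eq hxy.symm
    · intro hcard
      have hsurj : Function.Surjective f :=
        ((Nat.bijective_iff_injective_and_card f).2 ⟨hinj, hcard⟩).2
      have hlink : ∀ e x y, H.IsLink e x y → ∃ s, (f s : β) = e ∧ ∃ (hx : x ∈ V(H)) (hy : y ∈ V(H)),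
          s.1 = s(⟨x, hx⟩, ⟨y, hy⟩) := by
        intro e x y hxy
        obtain ⟨s, hs⟩ := hsurj ⟨e, hxy.edge_mem⟩
        refine ⟨s, congrArg Subtype.val hs, hxy.left_mem, hxy.right_mem, ?_⟩
        have h2 := hf2 s
        rw [hs] at h2
        rw [hf1 s]
        rcases hxy.eq_and_eq_or_eq_and_eq h2 with ⟨h3, h4⟩ | ⟨h3, h4⟩
        · exact Sym2.eq_iff.2 (Or.inl ⟨Subtype.ext h3.symm, Subtype.ext h4.symm⟩)
        · exact Sym2.eq_iff.2 (Or.inr ⟨Subtype.ext h4.symm, Subtype.ext h3.symm⟩)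
      refine { not_isLoopAt := fun e x he => ?_, eq_of_isLink := fun e e' x y he he' => ?_ }
      · obtain ⟨s, -, hx, hy, hs⟩ := hlink e x x he
        have := s.2
        rw [hs] at this
        exact H.toSimpleGraph.loopless.irrefl _ this
      · obtain ⟨s, rfl, hx, hy, hs⟩ := hlink e x y he
        obtain ⟨t, rfl, hx', hy', ht⟩ := hlink e' x y he'
        rw [Subtype.ext (hs.trans ht.symm)]
  have hcard := card_vert_le_card_edgeSet_add_card_connectedComponent H.toSimpleGraph
  rw [IsForest, hsimple, isAcyclic_iff_card_vert_eq, numComponents, ← Nat.card_coe_set_eq,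
    ← Nat.card_coe_set_eq]
  omega

lemma isConnected_iff_numComponents_eq_one (H : Graph α β) :
    IsConnected H ↔ numComponents H = 1 := by
  rw [numComponents, Nat.card_eq_one_iff_unique, IsConnected, SimpleGraph.connected_iff]
  refine and_congr ⟨fun h => h.subsingleton_connectedComponent, fun h x y => ?_⟩ ⟨fun h => ?_, ?_⟩
  · exact SimpleGraph.ConnectedComponent.exact (Subsingleton.elim _ _)
  · exact h.map H.toSimpleGraph.connectedComponentMk
  · rintro ⟨c⟩
    exact ⟨c.out⟩

end multigraph

/-! ### The darts of a multigraph -/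

section darts

variable {α : Type*} {β : Type*} {G : Graph α β} {src : E(G) × Bool → V(G)}

lemma ncard_src_eq (hfin : E(G).Finite)
    (hlink : ∀ e : E(G), G.IsLink e (src (e, false)) (src (e, true))) (v : V(G)) :
    {d | src d = v}.ncard = degree G v := by
  have : Finite E(G) := hfin
  set P : Set E(G) := {e | src (e, false) = v}
  set Q : Set E(G) := {e | src (e, true) = v}
  have hfib : {d | src d = v} = (fun e => (e, false)) '' P ∪ (fun e => (e, true)) '' Q := by
    ext ⟨e, b⟩
    cases b <;> simp [P, Q]
  have hloop : {e | G.IsLoopAt e v} = Subtype.val '' (P ∩ Q) := by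
    ext e
    constructor
    · intro he
      have h := hlink ⟨e, he.edge_mem⟩
      refine ⟨⟨e, he.edge_mem⟩, ⟨Subtype.ext ?_, Subtype.ext ?_⟩, rfl⟩
      · exact (he.eq_of_inc h.inc_left).symm
      · exact (he.eq_of_inc h.inc_right).symm
    · rintro ⟨e, ⟨h1, h2⟩, rfl⟩
      have h := hlink e
      rw [h1, h2] at h
      exact h
  have hnon : {e | G.IsNonloopAt e v} = Subtype.val '' ((P ∪ Q) \ (P ∩ Q)) := by
    ext e
    constructor
    · rintro ⟨y, hy, he⟩
      refine ⟨⟨e, he.edge_mem⟩, ?_, rfl⟩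
      rcases (hlink ⟨e, he.edge_mem⟩).eq_and_eq_or_eq_and_eq he with ⟨h1, h2⟩ | ⟨h1, h2⟩
      · exact ⟨Or.inl (Subtype.ext h1), fun h => hy (h2 ▸ congrArg Subtype.val h.2)⟩
      · exact ⟨Or.inr (Subtype.ext h2), fun h => hy (h1 ▸ congrArg Subtype.val h.1)⟩
    · rintro ⟨e, ⟨h1 | h1, h2⟩, rfl⟩
      · have h := hlink e
        rw [h1] at h
        exact ⟨_, fun hv => h2 ⟨h1, Subtype.ext hv⟩, h⟩
      · have h := hlink e
        rw [h1] at h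
        exact ⟨_, fun hv => h2 ⟨Subtype.ext hv, h1⟩, h.symm⟩
  have hdisj : Disjoint ((fun e => (e, false)) '' P) ((fun e : E(G) => (e, true)) '' Q) := by
    rw [Set.disjoint_left]
    rintro _ ⟨e, -, rfl⟩ ⟨e', -, h⟩
    simp at h
  have h1 := Set.ncard_union_add_ncard_inter P Q
  have h2 := Set.ncard_sdiff_add_ncard_of_subset
    (Set.inter_subset_left.trans Set.subset_union_left : P ∩ Q ⊆ P ∪ Q)
  rw [degree, hloop, hnon, hfib, Set.ncard_union_eq hdisj,
    Set.ncard_image_of_injective _ Subtype.val_injective,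
    Set.ncard_image_of_injective _ Subtype.val_injective,
    Set.ncard_image_of_injective _ fun _ _ h => congrArg Prod.fst h,
    Set.ncard_image_of_injective _ fun _ _ h => congrArg Prod.fst h]
  omega

variable (G) in
lemma exists_src :
    ∃ src : E(G) × Bool → V(G), ∀ e : E(G), G.IsLink e (src (e, false)) (src (e, true)) := by
  have h : ∀ e : E(G), ∃ p : V(G) × V(G), G.IsLink e p.1 p.2 := by
    rintro ⟨e, he⟩
    obtain ⟨x, y, hxy⟩ := Graph.exists_isLink_of_mem_edgeSet he
    exact ⟨⟨⟨x, hxy.left_mem⟩, ⟨y, hxy.right_mem⟩⟩, hxy⟩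
  choose p hp using h
  exact ⟨fun d => if d.2 then (p d.1).2 else (p d.1).1, fun e => by simpa using hp e⟩

lemma ncard_edgeSet_induce (hlink : ∀ e : E(G), G.IsLink e (src (e, false)) (src (e, true)))
    (B : Set α) :
    E(G.induce B).ncard =
      Nat.card {e : E(G) // (src (e, false) : α) ∈ B ∧ (src (e, true) : α) ∈ B} := by
  have : E(G.induce B) =
      Subtype.val '' {e : E(G) | (src (e, false) : α) ∈ B ∧ (src (e, true) : α) ∈ B} := by
    ext e
    rw [Graph.edgeSet_induce]
    constructor
    · rintro ⟨x, y, h, hx, hy⟩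
      refine ⟨⟨e, h.edge_mem⟩, ?_, rfl⟩
      change _ ∈ B ∧ _ ∈ B
      rcases (hlink ⟨e, h.edge_mem⟩).eq_and_eq_or_eq_and_eq h with ⟨h1, h2⟩ | ⟨h1, h2⟩
      · rw [h1, h2]
        exact ⟨hx, hy⟩
      · rw [h1, h2]
        exact ⟨hy, hx⟩
    · rintro ⟨e, h, rfl⟩
      exact ⟨_, _, hlink e, h.1, h.2⟩
  rw [this, Set.ncard_image_of_injective _ Subtype.val_injective, ← Nat.card_coe_set_eq]
  rfl

/-- Double counting of the darts with source in `S`: an edge with exactly one end in `S`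
contributes one dart, and the edges inside and outside of `S` deviate from this by one. -/
lemma card_add_card_inside_eq {ε W : Type*} [Fintype ε] {src : ε × Bool → W}
    (h3 : ∀ v, {d | src d = v}.ncard = 3) (S : Finset W) :
    Nat.card ε + Nat.card {e // src (e, false) ∈ S ∧ src (e, true) ∈ S} =
      3 * S.card + Nat.card {e // src (e, false) ∉ S ∧ src (e, true) ∉ S} := by
  classical
  have hfib : ∀ v ∈ S, ((Finset.univ.filter fun d => src d ∈ S).filter
      fun d => src d = v).card = 3 := by
    intro v hv
    rw [← h3 v, ← Set.ncard_coe_finset]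
    congr 1
    ext d
    simp only [Finset.coe_filter, Finset.mem_filter, Finset.mem_univ, true_and, Set.mem_ofPred_eq,
      and_iff_right_iff_imp]
    rintro rfl
    exact hv
  have hdarts := Finset.card_eq_sum_card_fiberwise (s := Finset.univ.filter fun d => src d ∈ S)
    (t := S) (f := src) fun d hd => by simpa using hd
  rw [Finset.sum_congr rfl hfib, Finset.sum_const, smul_eq_mul, Finset.card_filter,
    Fintype.sum_prod_type] at hdarts
  simp only [Fintype.sum_bool] at hdarts
  rw [mul_comm 3, ← hdarts]
  simp only [Nat.card_eq_fintype_card, Fintype.card_subtype, Finset.card_filter]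
  rw [← Finset.card_univ (α := ε), Finset.card_eq_sum_ones, ← Finset.sum_add_distrib,
    ← Finset.sum_add_distrib]
  refine Finset.sum_congr rfl fun e _ => ?_
  by_cases h1 : src (e, false) ∈ S <;> by_cases h2 : src (e, true) ∈ S <;> simp [h1, h2]

lemma dartSetoid_of_reachable
    (hlink : ∀ e : E(G), G.IsLink e (src (e, false)) (src (e, true)))
    {A : Set α} {S : Finset V(G)} (hS : ∀ v, v ∈ S ↔ (v : α) ∈ A)
    {x y : V(G.induce A)} (h : (G.induce A).toSimpleGraph.Reachable x y)
    {d d' : E(G) × Bool} (hd : (src d : α) = x) (hd' : (src d' : α) = y) :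
    dartSetoid src S d d' := by
  obtain ⟨p⟩ := h
  induction p generalizing d with
  | @nil u =>
    exact dartSetoid_of_src_eq (Subtype.ext (hd.trans hd'.symm)) ((hS _).2 (hd ▸ u.2))
  | @cons u v w hadj p ih =>
    have hdS : src d ∈ S := (hS _).2 (hd ▸ u.2)
    obtain ⟨-, e, he, -, -⟩ := hadj
    rcases he.eq_and_eq_or_eq_and_eq (hlink ⟨e, he.edge_mem⟩) with ⟨h1, h2⟩ | ⟨h1, h2⟩
    · exact (dartSetoid src S).trans (dartSetoid_of_src_eq (Subtype.ext (hd.trans h1)) hdS)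
        ((dartSetoid src S).trans (dartSetoid_flip _) (ih h2.symm hd'))
    · exact (dartSetoid src S).trans (dartSetoid_of_src_eq (Subtype.ext (hd.trans h1)) hdS)
        ((dartSetoid src S).trans (dartSetoid_flip _) (ih h2.symm hd'))

/-- When the vertices outside `A` are split into leaves, the components are those of the subgraph
induced by `A`, with their pendant edges, and the single edges outside `A`. -/
lemma card_dartSetoid_eq (hE : E(G).Finite) (hV : V(G).Finite)
    (hlink : ∀ e : E(G), G.IsLink e (src (e, false)) (src (e, true)))
    (h3 : ∀ v, {d | src d = v}.ncard = 3)
    {A : Set α} (hA : A ⊆ V(G)) {S : Finset V(G)} (hS : ∀ v, v ∈ S ↔ (v : α) ∈ A) :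
    Nat.card (Quotient (dartSetoid src S)) =
      numComponents (G.induce A) +
        Nat.card {e : E(G) // src (e, false) ∉ S ∧ src (e, true) ∉ S} := by
  classical
  have : Finite E(G) := hE
  have : Finite V(G.induce A) := hV.subset hA
  let H := (G.induce A).toSimpleGraph
  let vert : ∀ d, src d ∈ S → V(G.induce A) := fun d h => ⟨src d, (hS _).1 h⟩
  have hout : ∀ d, src d ∉ S → src (dartFlip _ d) ∉ S →
      src (d.1, false) ∉ S ∧ src (d.1, true) ∉ S := by
    rintro ⟨e, b⟩ h h'
    cases b
    exacts [⟨h, h'⟩, ⟨h', h⟩]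
  let F : E(G) × Bool → H.ConnectedComponent ⊕
      {e : E(G) // src (e, false) ∉ S ∧ src (e, true) ∉ S} := fun d =>
    if h : src d ∈ S then .inl (H.connectedComponentMk (vert d h))
    else if h' : src (dartFlip _ d) ∈ S then .inl (H.connectedComponentMk (vert _ h'))
    else .inr ⟨d.1, hout d h h'⟩
  have F1 : ∀ d (h : src d ∈ S), F d = .inl (H.connectedComponentMk (vert d h)) :=
    fun d h => dif_pos h
  have F2 : ∀ d (h : src d ∉ S) (h' : src (dartFlip _ d) ∉ S), F d = .inr ⟨d.1, hout d h h'⟩ :=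
    fun d h h' => (dif_neg h).trans (dif_neg h')
  have hflip : ∀ d, F d = F (dartFlip _ d) := by
    intro d
    by_cases h : src d ∈ S <;> by_cases h' : src (dartFlip _ d) ∈ S
    · rw [F1 d h, F1 _ h', Sum.inl.injEq, SimpleGraph.ConnectedComponent.eq]
      by_cases hne : vert d h = vert _ h'
      · rw [hne]
      · refine SimpleGraph.Adj.reachable ⟨hne, d.1, ?_, (hS _).1 h, (hS _).1 h'⟩
        obtain ⟨e, b⟩ := d
        cases b
        exacts [hlink e, (hlink e).symm]
    · simp only [F, h, h', dif_pos, dif_neg, not_false_iff, dartFlip_dartFlip]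
    · simp only [F, h, h', dif_pos, dif_neg, not_false_iff]
    · rw [F2 d h h', F2 _ h' (by rwa [dartFlip_dartFlip])]
      rfl
  have hle : dartSetoid src S ≤ Setoid.ker F := by
    refine dartSetoid_le hflip fun d d' h hd => ?_
    change F d = F d'
    rw [F1 d hd, F1 d' (h ▸ hd)]
    simp only [vert, h]
  rw [numComponents, ← Nat.card_sum]
  refine Nat.card_congr (Equiv.ofBijective (Quotient.lift F fun _ _ h => hle h) ⟨?_, ?_⟩)
  · have hinl : ∀ d d', src d ∈ S → src d' ∈ S → F d = F d' → dartSetoid src S d d' := by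
      intro d d' h h' he
      rw [F1 d h, F1 d' h', Sum.inl.injEq, SimpleGraph.ConnectedComponent.eq] at he
      exact dartSetoid_of_reachable hlink hS he rfl rfl
    have hrep : ∀ d, (∃ d₀, dartSetoid src S d d₀ ∧ src d₀ ∈ S) ∨
        (src d ∉ S ∧ src (dartFlip _ d) ∉ S) := by
      intro d
      by_cases h : src d ∈ S
      · exact Or.inl ⟨d, (dartSetoid src S).refl d, h⟩
      · by_cases h' : src (dartFlip _ d) ∈ S
        · exact Or.inl ⟨_, dartSetoid_flip d, h'⟩
        · exact Or.inr ⟨h, h'⟩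
    intro p q
    induction p using Quotient.inductionOn with | _ d
    induction q using Quotient.inductionOn with | _ d'
    intro he
    change F d = F d' at he
    refine Quotient.sound ?_
    change dartSetoid src S d d'
    rcases hrep d with ⟨d₀, h, h₀⟩ | h <;> rcases hrep d' with ⟨d₁, h', h₁⟩ | h'
    · refine (dartSetoid src S).trans h ((dartSetoid src S).trans (hinl _ _ h₀ h₁ ?_)
        ((dartSetoid src S).symm h'))
      exact (hle h).symm.trans (he.trans (hle h'))
    · have := (hle h).symm.trans he
      rw [F1 _ h₀, F2 _ h'.1 h'.2] at this
      cases this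
    · have := he.trans (hle h')
      rw [F1 _ h₁, F2 _ h.1 h.2] at this
      cases this
    · rw [F2 _ h.1 h.2, F2 _ h'.1 h'.2, Sum.inr.injEq, Subtype.mk.injEq] at he
      obtain ⟨e, b⟩ := d
      obtain ⟨e', b'⟩ := d'
      obtain rfl : e = e' := he
      cases b <;> cases b'
      exacts [(dartSetoid src S).refl _, dartSetoid_flip (e, false), dartSetoid_flip (e, true),
        (dartSetoid src S).refl _]
  · rintro (c | ⟨e, he⟩)
    · induction c using SimpleGraph.ConnectedComponent.ind with | _ x
      obtain ⟨d, hd⟩ : {d | src d = ⟨x, hA x.2⟩}.Nonempty :=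
        Set.nonempty_of_ncard_ne_zero (by rw [h3]; omega)
      have hd : src d = ⟨x, hA x.2⟩ := hd
      have hdS : src d ∈ S := (hS _).2 (by rw [hd]; exact x.2)
      refine ⟨Quotient.mk _ d, (F1 d hdS).trans ?_⟩
      simp only [vert, hd]
      rfl
    · exact ⟨Quotient.mk _ (e, false), F2 _ he.1 he.2⟩

end darts

/-! ### Embeddings and decycling partitions -/

section cubic

variable {α : Type*} {β : Type*} {G : Graph α β}

/-- The rotation of an embedding of a cubic graph is a rotation at all vertices. -/
lemma CellularEmbedding.isRotationOn_univ [Fintype V(G)] (M : CellularEmbedding G)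
    {src : E(G) × Bool → V(G)} (hsrc : ∀ d, (src d : α) = M.src d)
    (h3 : ∀ v, {d | src d = v}.ncard = 3) (hE : E(G).Finite) :
    IsRotationOn src Finset.univ M.rot := by
  classical
  have : Finite E(G) := hE
  have := Fintype.ofFinite E(G)
  have hiff : ∀ d d', M.rot.SameCycle d d' ↔ src d = src d' := fun d d' => by
    rw [M.sameCycle_rot_iff, ← hsrc, ← hsrc, Subtype.ext_iff]
  refine ⟨fun d => ((hiff _ _).1 (sameCycle_apply_right.2 (SameCycle.refl _ d))).symm,
    fun d hd => absurd (Finset.mem_univ _) hd, fun d d' _ h => ?_⟩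
  have hcard : (M.rot.cycleOf d).support.card ≤ 3 := by
    rw [← h3 (src d), ← Set.ncard_coe_finset]
    refine Set.ncard_le_ncard (fun x hx => ?_) (Set.toFinite _)
    exact ((hiff _ _).1 (mem_support_cycleOf_iff.1 hx).1).symm
  have hmoved : d ∈ M.rot.support := by
    rw [mem_support]
    intro hfix
    have hsub : {x | src x = src d} ⊆ {d} := by
      intro x hx
      exact ((hiff d x).2 (Eq.symm hx)).eq_of_left hfix |>.symm
    have := Set.ncard_le_ncard hsub (Set.finite_singleton d)
    rw [h3, Set.ncard_singleton] at this
    omega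
  obtain ⟨i, hi, hid⟩ := ((hiff d d').2 h.symm).exists_pow_eq_of_mem_support hmoved
  have hi3 : i < 3 := by omega
  interval_cases i
  · exact Or.inl hid.symm
  · exact Or.inr (Or.inl hid.symm)
  · exact Or.inr (Or.inr hid.symm)

lemma numComponents_pos {A : Set α} (hA : A.Nonempty) (hfin : A.Finite) :
    0 < numComponents (G.induce A) := by
  have : Finite V(G.induce A) := hfin
  obtain ⟨x, hx⟩ := hA
  have : Nonempty (G.induce A).toSimpleGraph.ConnectedComponent :=
    ⟨(G.induce A).toSimpleGraph.connectedComponentMk ⟨x, hx⟩⟩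
  exact Nat.card_pos

/-- For a partition of a cubic graph into `A` and `J`, the subgraph induced by `A` is a forest if
and only if, in the graph with the vertices of `J` split into leaves, every vertex of `A` merges
three components. -/
lemma isForest_induce_iff (hcubic : IsCubic G) {src : E(G) × Bool → V(G)}
    (hlink : ∀ e : E(G), G.IsLink e (src (e, false)) (src (e, true)))
    {A J : Set α} (hAJ : IsVertexPartition G A J) {S : Finset V(G)}
    (hS : ∀ v, v ∈ S ↔ (v : α) ∈ A) :
    Nat.card (Quotient (dartSetoid src S)) =
        numComponents (G.induce A) + E(G.induce J).ncard ∧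
      (IsForest (G.induce A) ↔
        Nat.card (Quotient (dartSetoid src S)) + 2 * S.card = Nat.card E(G)) := by
  have hE := hcubic.finite_edgeSet
  have hV := hcubic.finite_vertexSet
  have : Finite E(G) := hE
  have := Fintype.ofFinite E(G)
  have hA : A ⊆ V(G) := hAJ.1 ▸ Set.subset_union_left
  have hJ : ∀ v : V(G), (v : α) ∈ J ↔ v ∉ S := by
    intro v
    rw [hS]
    refine ⟨fun h h' => Set.disjoint_left.1 hAJ.2 h' h, fun h => ?_⟩
    have hv : (v : α) ∈ A ∪ J := hAJ.1.symm ▸ v.2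
    exact hv.resolve_left h
  have h3 : ∀ v, {d | src d = v}.ncard = 3 := fun v => by
    rw [ncard_src_eq hE hlink, hcubic.degree_eq v v.2]
  have hcomp := card_dartSetoid_eq hE hV hlink h3 hA hS
  have hedges := card_add_card_inside_eq h3 S
  have hin := ncard_edgeSet_induce hlink A
  have hout := ncard_edgeSet_induce hlink J
  simp only [hJ] at hout
  simp only [← hS] at hin
  have hEA : E(G.induce A).Finite := by
    refine hE.subset ?_
    rintro e ⟨x, y, h, -⟩
    exact h.edge_mem
  have hcard : S.card = V(G.induce A).ncard := by
    rw [← Set.ncard_coe_finset, ← Set.ncard_image_of_injective _ Subtype.val_injective]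
    congr 1
    ext x
    constructor
    · rintro ⟨v, hv, rfl⟩
      exact (hS v).1 hv
    · exact fun hx => ⟨⟨x, hA hx⟩, (hS _).2 hx, rfl⟩
  rw [isForest_iff_ncard_eq _ (hV.subset hA) hEA]
  omega

/-- An embedding with one or two faces yields a decycling partition. -/
lemma CellularEmbedding.exists_partition (hcubic : IsCubic G) (hne : V(G).Nonempty)
    (M : CellularEmbedding G) (h2 : M.numFaces ≤ 2) :
    ∃ A J : Set α, IsVertexPartition G A J ∧ IsForest (G.induce A) ∧
      0 < numComponents (G.induce A) ∧
      numComponents (G.induce A) + E(G.induce J).ncard = M.numFaces := by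
  classical
  have hE := hcubic.finite_edgeSet
  have hV := hcubic.finite_vertexSet
  have : Finite E(G) := hE
  have : Finite V(G) := hV
  have := Fintype.ofFinite E(G)
  have := Fintype.ofFinite V(G)
  have hmem : ∀ d, M.src d ∈ V(G) := by
    rintro ⟨e, b⟩
    cases b
    exacts [(M.isLink e).left_mem, (M.isLink e).right_mem]
  let src : E(G) × Bool → V(G) := fun d => ⟨M.src d, hmem d⟩
  have hlink : ∀ e : E(G), G.IsLink e (src (e, false)) (src (e, true)) := M.isLink
  have h3 : ∀ v, {d | src d = v}.ncard = 3 := fun v => by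
    rw [ncard_src_eq hE hlink, hcubic.degree_eq v v.2]
  have hrot := M.isRotationOn_univ (src := src) (fun _ => rfl) h3 hE
  obtain ⟨S, hS1, hS2⟩ := hrot.exists_card_dartSetoid_eq h3 h2
  have hAJ : IsVertexPartition G (Subtype.val '' (S : Set V(G)))
      (V(G) \ Subtype.val '' (S : Set V(G))) :=
    ⟨Set.union_sdiff_cancel (by rintro _ ⟨v, -, rfl⟩; exact v.2), Set.disjoint_sdiff_right⟩
  have hS : ∀ v : V(G), v ∈ S ↔ (v : α) ∈ Subtype.val '' (S : Set V(G)) := fun v => by simp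
  obtain ⟨hcomp, hforest⟩ := isForest_induce_iff hcubic hlink hAJ hS
  refine ⟨_, _, hAJ, hforest.2 hS2, numComponents_pos ?_ (Set.toFinite _), hcomp.symm.trans hS1⟩
  -- If `S` were empty, then the number of edges would be at most two, but `3 * |V| = 2 * |E|`.
  rw [Set.image_nonempty, Finset.coe_nonempty, Finset.nonempty_iff_ne_empty]
  rintro rfl
  have hedges := card_add_card_inside_eq h3 Finset.univ
  simp only [Finset.mem_univ, and_self, not_true_eq_false, Nat.card_of_isEmpty, add_zero,
    Nat.card_congr (Equiv.subtypeUnivEquiv fun _ : E(G) => trivial)] at hedges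
  have hpos : 0 < (Finset.univ : Finset V(G)).card :=
    Finset.card_pos.2 ⟨⟨_, hne.some_mem⟩, Finset.mem_univ _⟩
  change numCycles (M.rot * dartFlip E(G)) ≤ 2 at h2
  rw [Finset.card_empty] at hS2
  omega

/-- A decycling partition yields an embedding with one or two faces. -/
lemma exists_cellularEmbedding (hcubic : IsCubic G) {A J : Set α}
    (hAJ : IsVertexPartition G A J) (hforest : IsForest (G.induce A))
    (h2 : numComponents (G.induce A) + E(G.induce J).ncard ≤ 2) :
    ∃ M : CellularEmbedding G,
      M.numFaces = numComponents (G.induce A) + E(G.induce J).ncard := by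
  classical
  have hE := hcubic.finite_edgeSet
  have : Finite E(G) := hE
  have : Finite V(G) := hcubic.finite_vertexSet
  have := Fintype.ofFinite V(G)
  obtain ⟨src, hlink⟩ := exists_src G
  have h3 : ∀ v, {d | src d = v}.ncard = 3 := fun v => by
    rw [ncard_src_eq hE hlink, hcubic.degree_eq v v.2]
  obtain ⟨hcomp, hiff⟩ := isForest_induce_iff hcubic hlink hAJ
    (S := Finset.univ.filter fun v : V(G) => (v : α) ∈ A) (by simp)
  obtain ⟨σ, hσ, hcard⟩ := exists_isRotationOn_numCycles_eq_card_dartSetoid h3 (hiff.1 hforest)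
  rw [hcomp] at hcard
  obtain ⟨τ, hτ, hτcard⟩ := hσ.exists_extension h3 (hcard.trans_le h2) Finset.univ
  rw [Finset.union_eq_left.2 (Finset.subset_univ _)] at hτ
  refine ⟨{ src := fun d => src d, isLink := hlink, rot := τ, sameCycle_rot_iff := ?_ },
    hτcard.trans hcard⟩
  intro d d'
  rw [← Subtype.ext_iff]
  constructor
  · intro h
    exact CubicDecycling.setoid_sameCycle_le (t := Setoid.ker src)
      (fun x => (hτ.src_apply x).symm) h
  · intro h
    rcases hτ.eq_or_eq_or_eq d d' (Finset.mem_univ _) h.symm with rfl | rfl | rfl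
    · exact SameCycle.refl _ _
    · exact sameCycle_apply_right.2 (SameCycle.refl _ _)
    · exact sameCycle_apply_right.2 (sameCycle_apply_right.2 (SameCycle.refl _ _))

lemma isIndependent_iff_ncard_eq_zero (hE : E(G).Finite) (J : Set α) :
    IsIndependent G J ↔ E(G.induce J).ncard = 0 := by
  have hfin : E(G.induce J).Finite := by
    refine hE.subset ?_
    rintro e ⟨x, y, h, -⟩
    exact h.edge_mem
  rw [IsIndependent, Set.ncard_eq_zero hfin]

lemma isNearIndependent_iff_ncard_eq_one (J : Set α) :
    IsNearIndependent G J ↔ E(G.induce J).ncard = 1 := by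
  rw [IsNearIndependent, Set.ncard_eq_one]
  refine exists_congr fun e => ?_
  rw [Set.eq_singleton_iff_unique_mem]

end cubic

end CubicDecycling

open CubicDecycling in
theorem theorem3p5 {α : Type*} {β : Type*} (G : Graph α β)
    (hcubic : CubicDecycling.IsCubic G) (hconn : CubicDecycling.IsConnected G) :
    ((∃ M : CubicDecycling.CellularEmbedding G, M.numFaces = 2) ↔
      ∃ A J : Set α, CubicDecycling.IsVertexPartition G A J ∧
        ((CubicDecycling.IsTree (G.induce A) ∧ CubicDecycling.IsNearIndependent G J) ∨
          (CubicDecycling.IsForest (G.induce A) ∧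
            CubicDecycling.numComponents (G.induce A) = 2 ∧
            CubicDecycling.IsIndependent G J))) ∧
    ((∃ A J : Set α, CubicDecycling.IsStableDecyclingPartition G A J) ↔
      CubicDecycling.IsUpperEmbeddable G) := by
  have hne : V(G).Nonempty := Set.nonempty_coe_sort.1 hconn.nonempty
  simp only [IsStableDecyclingPartition, IsTree, isConnected_iff_numComponents_eq_one,
    isNearIndependent_iff_ncard_eq_one, isIndependent_iff_ncard_eq_zero hcubic.finite_edgeSet]
  refine ⟨⟨?_, ?_⟩, ⟨?_, ?_⟩⟩
  · rintro ⟨M, hM⟩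
    obtain ⟨A, J, hAJ, hforest, hpos, hcard⟩ := M.exists_partition hcubic hne hM.le
    refine ⟨A, J, hAJ, ?_⟩
    simp only [hforest, and_true, true_and]
    omega
  · rintro ⟨A, J, hAJ, ⟨⟨h1, hforest⟩, h2⟩ | ⟨hforest, h1, h2⟩⟩
    · obtain ⟨M, hM⟩ := exists_cellularEmbedding hcubic hAJ hforest (by omega)
      exact ⟨M, by omega⟩
    · obtain ⟨M, hM⟩ := exists_cellularEmbedding hcubic hAJ hforest (by omega)
      exact ⟨M, by omega⟩
  · rintro ⟨A, J, hAJ, h⟩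
    have hforest : IsForest (G.induce A) := by tauto
    have hle : numComponents (G.induce A) + E(G.induce J).ncard ≤ 2 := by omega
    obtain ⟨M, hM⟩ := exists_cellularEmbedding hcubic hAJ hforest hle
    exact ⟨M, hM.trans_le hle⟩
  · rintro ⟨M, hM⟩
    obtain ⟨A, J, hAJ, hforest, hpos, hcard⟩ := M.exists_partition hcubic hne hM
    refine ⟨A, J, hAJ, ?_⟩
    simp only [hforest, and_true, true_and]
    omega
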